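/- Let $S\subset\mathbb{R}$ be a finite set of servers with capacities $c:S\to\{1,2,3,\dots\}$. Requests $r_1,\dots,r_n\in\mathbb{R}$ with $n\le\sum_{s\in S}c(s)$ arrive one by one; an online algorithm must irrevocably match each request $r$, on arrival, with a free server $s$ (one matched so far with fewer than $c(s)$ requests), at cost $|r-s|$. For a request sequence $\sigma$ let $\mathcal A(\sigma)$ be the total cost of the algorithm $\mathcal A$ and $\mathrm{Opt}(\sigma)$ the minimum cost of an offline matching respecting the capacities. $\mathcal A$ is $\rho$-competitive if $\mathcal A(\sigma)\le\rho\,\mathrm{Opt}(\sigma)$ for all such $\sigma$, and its competitive ratio is $\inf\{\rho\ge 1:\mathcal A\text{ is }\rho\text{-competitive}\}$ (with $\inf\emptyset=\infty$). For $T=\{t_1<\dots<t_m\}\subseteq S$ let $L(T)=\dfrac{t_m-t_1}{\max_u(t_{u+1}-t_u)}$ if $m\ge2$ and $L(T)=0$ if $m\le 1$, and let $\alpha(S)=\max_{T\subseteq S}L(T)$. The algorithm PTCP matches a request $r$, when $F\subseteq S$ is the nonempty set of free servers, with the server $\mathcal A^*[S](r,F)$ defined recursively as follows. If $F=\{s\}$,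 then $\mathcal A^*[S](r,F)=s$. Otherwise let $S=\{s_1<\dots<s_k\}$, let $D=s_{a+1}-s_a$ be a largest distance between adjacent servers of $S$ (ties being broken by any fixed rule depending only on the server set), and put $S_1=\{s_1,\dots,s_a\}$, $S_2=\{s_{a+1},\dots,s_k\}$, $\Delta_1=s_a-s_1$, $\Delta_2=s_k-s_{a+1}$ and $x=\dfrac{\Delta_2+D}{(\Delta_1+D)+(\Delta_2+D)}\,D$. Then $\mathcal A^*[S](r,F)=\mathcal A^*[S_1](r,F\cap S_1)$ if ($r\le s_a+x$ and $F\cap S_1\ne\emptyset$) or $F\cap S_2=\emptyset$, and $\mathcal A^*[S](r,F)=\mathcal A^*[S_2](r,F\cap S_2)$ otherwise. A greedy algorithm matches each request with a nearest free server, ties being broken arbitrarily. **Theorem.** Let $k\ge 1$ and $S=\{s_1,\dots,s_k\}$ with $s_1=0$ and $s_i=2^{i-1}$ for $2\le i\le k$. Then $\alpha(S)\le 2$, with $\alpha(S)=2$ if $k\ge 3$. Moreover, for all capacities $c:S\to\{1,2,3,\dots\}$, PTCP is $5$-competitive (whatever the tie-breaking rule), and every greedy algorithm has competitive ratio at least $2^k-1$.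 -/

import Mathlib

noncomputable section

namespace OFAL

/-- A (partial) matching, as a list of pairs `(request, server)`, most recent request first. -/
abbrev Matching := List (ℝ × ℝ)

/-- The total cost of a matching: the sum of the distances between requests and their servers. -/
def cost (M : Matching) : ℝ := (M.map fun e => |e.1 - e.2|).sum

/-- The number of requests that `M` matches with the server `s`. -/
def load (M : Matching) (s : ℝ) : ℕ := (M.map Prod.snd).count s

/-- The servers of `S` that are free after the matching `M`. A server is identified with its
position on the line; only the values of the capacity `c` on `S` matter. -/
def free (S : Finset ℝ) (c : ℝ → ℕ) (M : Matching) : Finset ℝ :=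
  S.filter fun s => load M s < c s

/-- A deterministic online algorithm for the servers `S` with capacities `c`: from the matching
made so far (which records all earlier requests) and the new request it determines the
server for the new request, which is free whenever there is a free server at all. -/
structure OnlineAlgorithm (S : Finset ℝ) (c : ℝ → ℕ) where
  choose : Matching → ℝ → ℝ
  choose_mem : ∀ M r, (free S c M).Nonempty → choose M r ∈ free S c M

/-- The matching that results when `A`, having already built `M`, processes the requests `σ`
in order. -/
def OnlineAlgorithm.runFrom {S : Finset ℝ} {c : ℝ → ℕ} (A : OnlineAlgorithm S c) :
    Matching → List ℝ → Matching
  | M, [] => M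
  | M, r :: σ => A.runFrom ((r, A.choose M r) :: M) σ

/-- The total cost incurred when `A` processes the request sequence `σ`. -/
def OnlineAlgorithm.totalCost {S : Finset ℝ} {c : ℝ → ℕ} (A : OnlineAlgorithm S c)
    (σ : List ℝ) : ℝ := cost (A.runFrom [] σ)

/-- `M` matches the requests of `σ` with servers of `S` and respects the capacities. -/
def IsFeasible (S : Finset ℝ) (c : ℝ → ℕ) (σ : List ℝ) (M : Matching) : Prop :=
  M.map Prod.fst = σ.reverse ∧ (∀ e ∈ M, e.2 ∈ S) ∧ ∀ s ∈ S, load M s ≤ c s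

/-- The optimal offline cost. For `σ.length ≤ ∑ s ∈ S, c s` this is a minimum. -/
def opt (S : Finset ℝ) (c : ℝ → ℕ) (σ : List ℝ) : ℝ :=
  sInf {x | ∃ M, IsFeasible S c σ M ∧ x = cost M}

/-- Strict `ρ`-competitiveness, over all request sequences that the servers can serve. -/
def OnlineAlgorithm.IsCompetitive {S : Finset ℝ} {c : ℝ → ℕ} (A : OnlineAlgorithm S c)
    (ρ : ℝ) : Prop :=
  ∀ σ : List ℝ, σ.length ≤ ∑ s ∈ S, c s → A.totalCost σ ≤ ρ * opt S c σ

/-- The competitive ratio, the infimum of all `ρ ≥ 1` such that `A` is `ρ`-competitive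
(it is `⊤` if there is no such `ρ`). -/
def OnlineAlgorithm.competitiveRatio {S : Finset ℝ} {c : ℝ → ℕ} (A : OnlineAlgorithm S c) :
    EReal :=
  sInf ((fun ρ : ℝ => (ρ : EReal)) '' {ρ : ℝ | 1 ≤ ρ ∧ A.IsCompetitive ρ})

/-- `A` is a greedy algorithm: it matches each request with a nearest free server, ties being
broken arbitrarily. -/
def OnlineAlgorithm.IsGreedy {S : Finset ℝ} {c : ℝ → ℕ} (A : OnlineAlgorithm S c) : Prop :=
  ∀ M r, ∀ s ∈ free S c M, |r - A.choose M r| ≤ |r - s|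

/-- `u < v` are adjacent points of `T`. -/
def IsAdjacent (T : Finset ℝ) (u v : ℝ) : Prop :=
  u ∈ T ∧ v ∈ T ∧ u < v ∧ ∀ t ∈ T, ¬ (u < t ∧ t < v)

/-- `u < v` are adjacent points of `T` at the largest distance of adjacent points. -/
def IsMaxGap (T : Finset ℝ) (u v : ℝ) : Prop :=
  IsAdjacent T u v ∧ ∀ u' v', IsAdjacent T u' v' → v' - u' ≤ v - u

/-- The largest distance between adjacent points of `T`. -/
def maxGap (T : Finset ℝ) : ℝ := sSup {d | ∃ u v, IsAdjacent T u v ∧ d = v - u}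

theorem nonempty_of_two_le {T : Finset ℝ} (h : 2 ≤ T.card) : T.Nonempty :=
  Finset.card_pos.mp (by omega)

/-- The diameter of `T` divided by the largest distance between adjacent points. -/
def L (T : Finset ℝ) : ℝ :=
  if h : 2 ≤ T.card then
    (T.max' (nonempty_of_two_le h) - T.min' (nonempty_of_two_le h)) / maxGap T
  else 0

/-- The maximum of `L T` over all `T ⊆ S`. -/
def alpha (S : Finset ℝ) : ℝ := S.powerset.sup' (Finset.powerset_nonempty S) L

/-- A choice of a largest gap `left T < right T` in each `T` with at least two points. It
only matters when several gaps are largest. -/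
structure SplitRule where
  left : Finset ℝ → ℝ
  right : Finset ℝ → ℝ
  isMaxGap : ∀ T, 2 ≤ T.card → IsMaxGap T (left T) (right T)

/-- The servers of `S` up to the left end of the chosen largest gap. -/
def SplitRule.S₁ (g : SplitRule) (S : Finset ℝ) : Finset ℝ := S.filter (· ≤ g.left S)

/-- The servers of `S` from the right end of the chosen largest gap on. -/
def SplitRule.S₂ (g : SplitRule) (S : Finset ℝ) : Finset ℝ := S.filter (g.right S ≤ ·)

theorem SplitRule.card_S₁_lt (g : SplitRule) {S : Finset ℝ} (h : 2 ≤ S.card) :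
    (g.S₁ S).card < S.card := by
  obtain ⟨⟨-, hv, huv, -⟩, -⟩ := g.isMaxGap S h
  exact Finset.card_lt_card (Finset.filter_ssubset.mpr ⟨_, hv, not_le.mpr huv⟩)

theorem SplitRule.card_S₂_lt (g : SplitRule) {S : Finset ℝ} (h : 2 ≤ S.card) :
    (g.S₂ S).card < S.card := by
  obtain ⟨⟨hu, -, huv, -⟩, -⟩ := g.isMaxGap S h
  exact Finset.card_lt_card (Finset.filter_ssubset.mpr ⟨_, hu, not_le.mpr huv⟩)

/-- The distance `x` from the left end of the chosen largest gap to the critical point. -/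
def SplitRule.offset (g : SplitRule) (S : Finset ℝ) (h : 2 ≤ S.card) : ℝ :=
  let Δ₁ := g.left S - S.min' (nonempty_of_two_le h)
  let Δ₂ := S.max' (nonempty_of_two_le h) - g.right S
  let D := g.right S - g.left S
  (Δ₂ + D) / ((Δ₁ + D) + (Δ₂ + D)) * D

open Classical in
/-- The server with which PTCP for the servers `S` matches the request `r` when `F ⊆ S` is
the nonempty set of free servers (the last branch does not occur for such `F`). -/
def ptcpServer (g : SplitRule) (S : Finset ℝ) (r : ℝ) (F : Finset ℝ) : ℝ :=
  if hF : ∃ s, F = {s} then hF.choose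
  else if h : 2 ≤ S.card then
    if (r ≤ g.left S + g.offset S h ∧ (F ∩ g.S₁ S).Nonempty) ∨ F ∩ g.S₂ S = ∅ then
      ptcpServer g (g.S₁ S) r (F ∩ g.S₁ S)
    else
      ptcpServer g (g.S₂ S) r (F ∩ g.S₂ S)
  else 0
termination_by S.card
decreasing_by
  · exact g.card_S₁_lt h
  · exact g.card_S₂_lt h

theorem ptcpServer_mem (g : SplitRule) (r : ℝ) (S F : Finset ℝ) (hFS : F ⊆ S)
    (hne : F.Nonempty) : ptcpServer g S r F ∈ F := by
  induction hn : S.card using Nat.strong_induction_on generalizing S F with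
  | _ n ih =>
  subst hn
  rw [ptcpServer]
  by_cases hF : ∃ s, F = {s}
  · rw [dif_pos hF]
    have h := hF.choose_spec
    generalize hF.choose = t at h
    simp [h]
  rw [dif_neg hF]
  have h2 : 2 ≤ S.card := by
    have h1 := Finset.card_pos.mpr hne
    have h3 : F.card ≠ 1 := fun h => hF (Finset.card_eq_one.mp h)
    have h4 := Finset.card_le_card hFS
    omega
  rw [dif_pos h2]
  obtain ⟨⟨-, -, -, hadj⟩, -⟩ := g.isMaxGap S h2
  have hcover : ∀ t ∈ F, t ∈ F ∩ g.S₁ S ∨ t ∈ F ∩ g.S₂ S := by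
    intro t ht
    have h5 := hadj t (hFS ht)
    by_cases h6 : t ≤ g.left S
    · exact Or.inl (by simp [SplitRule.S₁, ht, hFS ht, h6])
    · have h7 : g.right S ≤ t := by
        by_contra h8
        exact h5 ⟨not_le.mp h6, not_le.mp h8⟩
      exact Or.inr (by simp [SplitRule.S₂, ht, hFS ht, h7])
  split_ifs with hc
  · have hne1 : (F ∩ g.S₁ S).Nonempty := by
      rcases hc with hc | hc
      · exact hc.2
      · obtain ⟨t, ht⟩ := hne
        rcases hcover t ht with h | h
        · exact ⟨t, h⟩
        · simp [hc] at h
    exact Finset.inter_subset_left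
      (ih _ (g.card_S₁_lt h2) _ _ Finset.inter_subset_right hne1 rfl)
  · have hne2 : (F ∩ g.S₂ S).Nonempty :=
      Finset.nonempty_iff_ne_empty.mpr fun h => hc (Or.inr h)
    exact Finset.inter_subset_left
      (ih _ (g.card_S₂_lt h2) _ _ Finset.inter_subset_right hne2 rfl)

/-- The online algorithm PTCP (Policy Transition at Critical Point), with the largest gaps
chosen by `g`. -/
def ptcp (g : SplitRule) (S : Finset ℝ) (c : ℝ → ℕ) : OnlineAlgorithm S c where
  choose M r := ptcpServer g S r (free S c M)
  choose_mem M r h := ptcpServer_mem g r S (free S c M) (Finset.filter_subset _ _) h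

/-- The position of the `i`-th server: `s₁ = 0` and `sᵢ = 2 ^ (i - 1)` for `i ≥ 2`. -/
def serverPos (i : ℕ) : ℝ := if i = 1 then 0 else 2 ^ (i - 1)

/-- The server layout `s₁, …, s_k`. -/
def layout (k : ℕ) : Finset ℝ := (Finset.Icc 1 k).image serverPos

end OFAL

end

/-!
Let `l y` and `r y` be the numbers of pairs of a matching that cross the point `y` to the left and
to the right. Its cost is `∫ (l + r) = ∫ |l - r| + 2 ∫ min l r`. When all capacity is used up, the
net flow `l - r` is the same for all matchings, so `∫ |l - r|` is a lower bound for the optimum, and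
PTCP is `(2α + 1)`-competitive as soon as its matching satisfies `∫ min l r ≤ α ∫ |l - r|`.

This follows by recursion over the largest gaps. Let `p` and `q` be the extreme servers of a subset
with chosen gap `[u, v]` and critical point `κ`. Requests are sent across `κ` only when the servers
on their own side are full, hence in one direction only. Such requests add to `∫ min l r` on their
own side of `κ`, but they are net flow on the part of the gap on the other side of `κ`. The critical
point is placed such that `(q - κ) / (κ - u) = (κ - p) / (v - κ) = (q - p) / (v - u)`, and the last
quotient is at most `α`, so the gain makes up for the loss.

A greedy algorithm is led astray by the requests `2 ^ i + ε`: each goes to the server `2 ^ (i + 1)`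
to its right, and the last one has to return to `0`, whereas shifting all of them one server to the
left costs only `1 + k * ε`.
-/

namespace OFAL

open MeasureTheory Filter Topology

section Matching

variable {S : Finset ℝ} {c c' : ℝ → ℕ} {σ τ : List ℝ} {M N : Matching}

theorem cost_cons (e : ℝ × ℝ) (M : Matching) : cost (e :: M) = |e.1 - e.2| + cost M := by
  simp [cost]

theorem cost_append (M N : Matching) : cost (M ++ N) = cost M + cost N := by
  simp [cost]

theorem cost_nonneg (M : Matching) : 0 ≤ cost M := by
  induction M with
  | nil => simp [cost]
  | cons e M ih => rw [cost_cons]; positivity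

theorem load_cons (r a s : ℝ) (M : Matching) :
    load ((r, a) :: M) s = load M s + if a = s then 1 else 0 := by
  simp [load, List.count_cons]

theorem load_append (M N : Matching) (s : ℝ) : load (M ++ N) s = load M s + load N s := by
  simp [load]

theorem sum_load (h : ∀ e ∈ M, e.2 ∈ S) : ∑ s ∈ S, load M s = M.length := by
  simpa [load] using Multiset.sum_count_eq_card (s := S) (m := (M.map Prod.snd : Multiset ℝ))
    (by simpa using fun s r hrs => h (r, s) hrs)

theorem mem_free {s : ℝ} : s ∈ free S c M ↔ s ∈ S ∧ load M s < c s := Finset.mem_filter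

theorem free_nonempty (h : ∀ e ∈ M, e.2 ∈ S) (hlt : M.length < ∑ s ∈ S, c s) :
    (free S c M).Nonempty := by
  rw [← sum_load h] at hlt
  obtain ⟨s, hs, hs'⟩ := Finset.exists_lt_of_sum_lt hlt
  exact ⟨s, mem_free.mpr ⟨hs, hs'⟩⟩

theorem free_subset_of_isSuffix (h : M <:+ N) : free S c N ⊆ free S c M := by
  intro s hs
  obtain ⟨hsS, hlt⟩ := mem_free.mp hs
  exact mem_free.mpr ⟨hsS, ((h.sublist.map Prod.snd).count_le s).trans_lt hlt⟩

theorem free_cons_of_le_load_add_one {r a : ℝ} (h : c a ≤ load M a + 1) :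
    free S c ((r, a) :: M) = (free S c M).erase a := by
  ext s
  simp only [mem_free, Finset.mem_erase, load_cons]
  by_cases hs : a = s
  · subst hs
    simp [h]
  · simp [hs, Ne.symm hs]

theorem IsFeasible.length_eq (hM : IsFeasible S c σ M) : M.length = σ.length := by
  simpa using congrArg List.length hM.1

theorem IsFeasible.length_le (hM : IsFeasible S c σ M) : σ.length ≤ ∑ s ∈ S, c s := by
  rw [← hM.length_eq, ← sum_load hM.2.1]
  exact Finset.sum_le_sum hM.2.2

theorem IsFeasible.mono (hM : IsFeasible S c σ M) (h : ∀ s ∈ S, c s ≤ c' s) :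
    IsFeasible S c' σ M :=
  ⟨hM.1, hM.2.1, fun s hs => (hM.2.2 s hs).trans (h s hs)⟩

theorem IsFeasible.append (hM : IsFeasible S c σ M) (hN : IsFeasible S c' τ N) :
    IsFeasible S (c + c') (σ ++ τ) (N ++ M) := by
  refine ⟨by simp [hM.1, hN.1], fun e he => ?_, fun s hs => ?_⟩
  · exact (List.mem_append.mp he).elim (hN.2.1 e) (hM.2.1 e)
  · rw [load_append, add_comm]
    exact add_le_add (hM.2.2 s hs) (hN.2.2 s hs)

theorem IsFeasible.load_eq (hM : IsFeasible S c σ M) (hσ : σ.length = ∑ s ∈ S, c s) :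
    ∀ s ∈ S, load M s = c s := by
  rw [← hM.length_eq, ← sum_load hM.2.1] at hσ
  exact (Finset.sum_eq_sum_iff_of_le hM.2.2).mp hσ

theorem IsFeasible.load_eq_zero (hM : IsFeasible S c σ M) {s : ℝ} (hs : s ∉ S) :
    load M s = 0 := by
  refine List.count_eq_zero_of_not_mem fun h => hs ?_
  obtain ⟨e, he, rfl⟩ := List.mem_map.mp h
  exact hM.2.1 e he

theorem IsFeasible.perm_servers (hM : IsFeasible S c σ M) (hN : IsFeasible S c σ N)
    (hσ : σ.length = ∑ s ∈ S, c s) : (M.map Prod.snd).Perm (N.map Prod.snd) := by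
  refine List.perm_iff_count.mpr fun s => ?_
  change load M s = load N s
  by_cases hs : s ∈ S
  · rw [hM.load_eq hσ s hs, hN.load_eq hσ s hs]
  · rw [hM.load_eq_zero hs, hN.load_eq_zero hs]

theorem opt_le_cost (hM : IsFeasible S c σ M) : opt S c σ ≤ cost M :=
  csInf_le ⟨0, by rintro _ ⟨N, -, rfl⟩; exact cost_nonneg N⟩ ⟨M, hM, rfl⟩

theorem opt_nonneg (S : Finset ℝ) (c : ℝ → ℕ) (σ : List ℝ) : 0 ≤ opt S c σ :=
  Real.sInf_nonneg (by rintro _ ⟨N, -, rfl⟩; exact cost_nonneg N)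

/-- The matching that serves each request of `τ` at its own position, which costs nothing. It is
used to fill up unwanted capacity. -/
def diagonal (τ : List ℝ) : Matching := (τ.map fun s => (s, s)).reverse

theorem cost_diagonal (τ : List ℝ) : cost (diagonal τ) = 0 := by
  simp [cost, diagonal, Function.comp_def]

theorem load_diagonal (τ : List ℝ) : load (diagonal τ) = fun s => τ.count s := by
  ext s
  simp [load, diagonal, Function.comp_def]

theorem isFeasible_diagonal (hτ : ∀ s ∈ τ, s ∈ S) :
    IsFeasible S (fun s => τ.count s) τ (diagonal τ) :=
  ⟨by simp [diagonal, Function.comp_def], by simpa [diagonal] using hτ,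
    fun s _ => (congrFun (load_diagonal τ) s).le⟩

theorem exists_list_count (S : Finset ℝ) (n : ℝ → ℕ) :
    ∃ τ : List ℝ, (∀ s ∈ τ, s ∈ S) ∧ ∀ s ∈ S, τ.count s = n s := by
  refine ⟨(∑ s ∈ S, Multiset.replicate (n s) s).toList, fun s hs => ?_, fun s hs => ?_⟩
  · rw [Multiset.mem_toList, Multiset.mem_sum] at hs
    obtain ⟨t, ht, hst⟩ := hs
    rwa [Multiset.eq_of_mem_replicate hst]
  · rw [← Multiset.coe_count, Multiset.coe_toList, Multiset.count_sum']
    simp [Multiset.count_replicate, hs]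

theorem IsFeasible.exists_append_diagonal (hM : IsFeasible S c σ M) :
    ∃ τ, (σ ++ τ).length = ∑ s ∈ S, c s ∧ IsFeasible S c (σ ++ τ) (diagonal τ ++ M) := by
  obtain ⟨τ, hτS, hτ⟩ := exists_list_count S fun s => c s - load M s
  have hfill : ∀ s ∈ S, load M s + τ.count s = c s := fun s hs => by
    rw [hτ s hs, Nat.add_sub_cancel' (hM.2.2 s hs)]
  have hM' : IsFeasible S (load M) σ M := ⟨hM.1, hM.2.1, fun _ _ => le_rfl⟩
  have hfeas : IsFeasible S c (σ ++ τ) (diagonal τ ++ M) :=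
    (hM'.append (isFeasible_diagonal hτS)).mono fun s hs => (hfill s hs).le
  refine ⟨τ, ?_, hfeas⟩
  rw [← hfeas.length_eq, ← sum_load hfeas.2.1]
  refine Finset.sum_congr rfl fun s hs => ?_
  rw [load_append, load_diagonal, add_comm, hfill s hs]

end Matching

section OnlineAlgorithm

variable {S T : Finset ℝ} {c : ℝ → ℕ} {A : OnlineAlgorithm S c} {f : Matching → ℝ → ℝ}
  {E : Matching}

theorem runFrom_append (A : OnlineAlgorithm S c) (M : Matching) (σ τ : List ℝ) :
    A.runFrom M (σ ++ τ) = A.runFrom (A.runFrom M σ) τ := by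
  induction σ generalizing M with
  | nil => rfl
  | cons r _ ih => exact ih _

theorem map_fst_runFrom (A : OnlineAlgorithm S c) (M : Matching) (σ : List ℝ) :
    (A.runFrom M σ).map Prod.fst = σ.reverse ++ M.map Prod.fst := by
  induction σ generalizing M with
  | nil => rfl
  | cons r σ ih => rw [OnlineAlgorithm.runFrom, ih]; simp

theorem cost_le_cost_runFrom (A : OnlineAlgorithm S c) (M : Matching) (σ : List ℝ) :
    cost M ≤ cost (A.runFrom M σ) := by
  induction σ generalizing M with
  | nil => exact le_rfl
  | cons r σ ih =>
    refine le_trans ?_ (ih _)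
    rw [cost_cons]
    exact le_add_of_nonneg_left (abs_nonneg _)

theorem totalCost_le_totalCost_append (A : OnlineAlgorithm S c) (σ τ : List ℝ) :
    A.totalCost σ ≤ A.totalCost (σ ++ τ) := by
  rw [OnlineAlgorithm.totalCost, OnlineAlgorithm.totalCost, runFrom_append]
  exact cost_le_cost_runFrom _ _ _

/-- `E` can arise online under the policy `f`, as far as the servers in `T` are concerned: each
pair of `E` uses a server that was free at that time, and if this server lies in `T`, it is the one
that `f` chooses from the earlier pairs and the request. Earlier pairs come later in the list, so
the history of a pair is the suffix of `E` behind it. -/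
def FollowsOn (S : Finset ℝ) (c : ℝ → ℕ) (T : Finset ℝ) (f : Matching → ℝ → ℝ) (E : Matching) :
    Prop :=
  ∀ r a M, (r, a) :: M <:+ E → a ∈ free S c M ∧ (a ∈ T → a = f M r)

theorem followsOn_nil : FollowsOn S c T f [] := fun _ _ _ h => by simp at h

theorem FollowsOn.cons (hE : FollowsOn S c T f E) {r a : ℝ} (ha : a ∈ free S c E)
    (haf : a ∈ T → a = f E r) : FollowsOn S c T f ((r, a) :: E) := by
  intro r' a' M hM
  rcases List.suffix_cons_iff.mp hM with heq | hM
  · simp only [List.cons.injEq, Prod.mk.injEq] at heq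
    obtain ⟨⟨rfl, rfl⟩, rfl⟩ := heq
    exact ⟨ha, haf⟩
  · exact hE r' a' M hM

theorem FollowsOn.mem (hE : FollowsOn S c T f E) : ∀ e ∈ E, e.2 ∈ S := by
  rintro ⟨r, a⟩ he
  obtain ⟨l, M, rfl⟩ := List.append_of_mem he
  exact (mem_free.mp (hE r a M (List.suffix_append _ _)).1).1

theorem FollowsOn.load_le (hE : FollowsOn S c T f E) (s : ℝ) : load E s ≤ c s := by
  induction E with
  | nil => simp [load]
  | cons e E ih =>
    have hlt := (mem_free.mp (hE e.1 e.2 E List.suffix_rfl).1).2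
    have hle := ih fun r a M hM => hE r a M (hM.trans (List.suffix_cons _ _))
    rw [load_cons]
    split_ifs with h
    · rwa [← h]
    · exact hle

theorem followsOn_runFrom {M : Matching} (hM : FollowsOn S c S A.choose M) {σ : List ℝ}
    (h : M.length + σ.length ≤ ∑ s ∈ S, c s) : FollowsOn S c S A.choose (A.runFrom M σ) := by
  induction σ generalizing M with
  | nil => exact hM
  | cons r σ ih =>
    simp only [List.length_cons] at h
    have hfree := A.choose_mem M r (free_nonempty hM.mem (by omega))
    exact ih (hM.cons hfree fun _ => rfl) (by simp only [List.length_cons]; omega)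

theorem isFeasible_runFrom_nil (A : OnlineAlgorithm S c) {σ : List ℝ}
    (h : σ.length ≤ ∑ s ∈ S, c s) : IsFeasible S c σ (A.runFrom [] σ) := by
  have hrun := followsOn_runFrom (A := A) followsOn_nil (σ := σ) (by simpa using h)
  exact ⟨by simp [map_fst_runFrom], hrun.mem, fun s _ => hrun.load_le s⟩

theorem isCompetitive_of_forall_isFeasible {ρ : ℝ} (hρ : 0 < ρ)
    (h : ∀ σ M, IsFeasible S c σ M → A.totalCost σ ≤ ρ * cost M) : A.IsCompetitive ρ := by
  intro σ hσ
  rw [← div_le_iff₀' hρ]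
  refine le_csInf ⟨_, _, isFeasible_runFrom_nil A hσ, rfl⟩ ?_
  rintro _ ⟨M, hM, rfl⟩
  exact (div_le_iff₀' hρ).mpr (h σ M hM)

theorem isCompetitive_mono {ρ ρ' : ℝ} (hA : A.IsCompetitive ρ) (h : ρ ≤ ρ') :
    A.IsCompetitive ρ' := fun σ hσ =>
  (hA σ hσ).trans (mul_le_mul_of_nonneg_right h (opt_nonneg S c σ))

end OnlineAlgorithm

section Crossing

variable {E M : Matching} {α p q y : ℝ}

/-- The number of pairs of `E` that cross `y` from right to left: the request is right of `y` (or at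
`y`), its server left of `y`. -/
noncomputable def leftCross (E : Matching) (y : ℝ) : ℕ := E.countP fun e => e.2 < y ∧ y ≤ e.1

/-- The number of pairs of `E` that cross `y` from left to right: the request is left of `y`, its
server right of `y` (or at `y`). -/
noncomputable def rightCross (E : Matching) (y : ℝ) : ℕ := E.countP fun e => e.1 < y ∧ y ≤ e.2

theorem countP_le_countP_of_imp {β : Type*} {l : List β} {P Q : β → Prop} [DecidablePred P]
    [DecidablePred Q] (h : ∀ x ∈ l, P x → Q x) :
    l.countP (fun x => P x) ≤ l.countP fun x => Q x :=
  List.countP_mono_left (by simpa using h)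

theorem rightCross_map_swap (E : Matching) : rightCross (E.map Prod.swap) = leftCross E := by
  ext y
  simp [rightCross, leftCross, List.countP_map, Function.comp_def]

theorem rightCross_cons (e : ℝ × ℝ) (E : Matching) (y : ℝ) :
    (rightCross (e :: E) y : ℝ) = rightCross E y + (Set.Ioc e.1 e.2).indicator 1 y := by
  simp [rightCross, List.countP_cons, Set.indicator_apply]

theorem integrable_indicator_Ioc (a b : ℝ) :
    Integrable ((Set.Ioc a b).indicator (1 : ℝ → ℝ)) :=
  (integrableOn_const (C := (1 : ℝ)) (by simp)).integrable_indicator measurableSet_Ioc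

theorem integrable_rightCross (E : Matching) : Integrable fun y => (rightCross E y : ℝ) := by
  induction E with
  | nil => simp [rightCross]
  | cons e E ih =>
    simp only [rightCross_cons]
    exact ih.add (integrable_indicator_Ioc _ _)

theorem integrable_leftCross (E : Matching) : Integrable fun y => (leftCross E y : ℝ) := by
  simpa only [rightCross_map_swap] using integrable_rightCross (E.map Prod.swap)

theorem integral_rightCross (E : Matching) :
    ∫ y, (rightCross E y : ℝ) = (E.map fun e => max (e.2 - e.1) 0).sum := by
  induction E with
  | nil => simp [rightCross]
  | cons e E ih =>
    simp only [rightCross_cons]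
    rw [integral_add (integrable_rightCross E) (integrable_indicator_Ioc _ _), ih,
      integral_indicator_one measurableSet_Ioc, Real.volume_real_Ioc, List.map_cons,
      List.sum_cons, add_comm]

theorem integral_leftCross (E : Matching) :
    ∫ y, (leftCross E y : ℝ) = (E.map fun e => max (e.1 - e.2) 0).sum := by
  simpa [rightCross_map_swap, Function.comp_def] using integral_rightCross (E.map Prod.swap)

theorem integral_leftCross_add_rightCross (E : Matching) :
    ∫ y, ((leftCross E y : ℝ) + rightCross E y) = cost E := by
  rw [integral_add (integrable_leftCross E) (integrable_rightCross E), integral_leftCross,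
    integral_rightCross, cost, ← List.sum_map_add]
  congr 1
  refine List.map_congr_left fun e _ => ?_
  rw [← max_zero_add_max_neg_zero_eq_abs_self, neg_sub]

theorem rightCross_add_countP_servers (E : Matching) (y : ℝ) :
    rightCross E y + (E.map Prod.snd).countP (· < y) =
      leftCross E y + (E.map Prod.fst).countP (· < y) := by
  induction E with
  | nil => rfl
  | cons e E ih =>
    simp only [rightCross, leftCross, List.map_cons, List.countP_cons, decide_eq_true_eq] at ih ⊢
    by_cases h₁ : e.1 < y <;> by_cases h₂ : e.2 < y <;>
      simp only [h₁, h₂, not_lt.mp, not_le.mpr, and_self, and_true, and_false,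
        not_false_eq_true, if_true, if_false] <;> omega

/-- The net flow across `y` is determined by the positions of the requests and of the used
servers. -/
theorem rightCross_add_leftCross_comm (hreq : E.map Prod.fst = M.map Prod.fst)
    (hsrv : (E.map Prod.snd).Perm (M.map Prod.snd)) (y : ℝ) :
    rightCross E y + leftCross M y = rightCross M y + leftCross E y := by
  have hE := rightCross_add_countP_servers E y
  have hM := rightCross_add_countP_servers M y
  rw [hreq, hsrv.countP_eq] at hE
  omega

/-- The amount by which the circulation across `y`, i.e. the smaller one of the two crossing
numbers, exceeds `α` times the net flow. -/
noncomputable def excess (α : ℝ) (E : Matching) (y : ℝ) : ℝ :=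
  min (leftCross E y : ℝ) (rightCross E y) - α * |(leftCross E y : ℝ) - rightCross E y|

theorem leftCross_add_rightCross_eq (α : ℝ) (E : Matching) (y : ℝ) :
    (leftCross E y : ℝ) + rightCross E y =
      2 * excess α E y + (2 * α + 1) * |(leftCross E y : ℝ) - rightCross E y| := by
  have hmin := two_nsmul_inf_eq_add_sub_abs_sub (leftCross E y : ℝ) (rightCross E y)
  rw [nsmul_eq_mul, Nat.cast_ofNat, abs_sub_comm] at hmin
  rw [excess]
  linear_combination -hmin

theorem integrable_abs_leftCross_sub_rightCross (E : Matching) :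
    Integrable fun y => |(leftCross E y : ℝ) - rightCross E y| :=
  ((integrable_leftCross E).sub (integrable_rightCross E)).abs

theorem integrable_excess (α : ℝ) (E : Matching) : Integrable (excess α E) :=
  ((integrable_leftCross E).inf (integrable_rightCross E)).sub
    ((integrable_abs_leftCross_sub_rightCross E).const_mul α)

theorem intervalIntegrable_excess (α : ℝ) (E : Matching) (a b : ℝ) :
    IntervalIntegrable (excess α E) volume a b :=
  (integrable_excess α E).intervalIntegrable

theorem cost_le_of_integral_excess_nonpos (hα : 0 ≤ α) (hE : ∫ y, excess α E y ≤ 0)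
    (hreq : E.map Prod.fst = M.map Prod.fst) (hsrv : (E.map Prod.snd).Perm (M.map Prod.snd)) :
    cost E ≤ (2 * α + 1) * cost M := by
  have hnet (y : ℝ) :
      |(leftCross E y : ℝ) - rightCross E y| ≤ (leftCross M y : ℝ) + rightCross M y := by
    have hflow : (rightCross E y : ℝ) + leftCross M y = rightCross M y + leftCross E y :=
      mod_cast rightCross_add_leftCross_comm hreq hsrv y
    have : (0 : ℝ) ≤ leftCross M y := Nat.cast_nonneg _
    have : (0 : ℝ) ≤ rightCross M y := Nat.cast_nonneg _
    exact abs_le.mpr ⟨by linarith, by linarith⟩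
  calc cost E = ∫ y, ((leftCross E y : ℝ) + rightCross E y) :=
        (integral_leftCross_add_rightCross E).symm
    _ = 2 * (∫ y, excess α E y) +
          (2 * α + 1) * ∫ y, |(leftCross E y : ℝ) - rightCross E y| := by
        simp only [leftCross_add_rightCross_eq α]
        rw [integral_add ((integrable_excess α E).const_mul 2)
          ((integrable_abs_leftCross_sub_rightCross E).const_mul _), integral_const_mul,
          integral_const_mul]
    _ ≤ (2 * α + 1) * ∫ y, |(leftCross E y : ℝ) - rightCross E y| := by linarith
    _ ≤ (2 * α + 1) * ∫ y, ((leftCross M y : ℝ) + rightCross M y) := by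
        refine mul_le_mul_of_nonneg_left (integral_mono ?_ ?_ hnet) (by linarith)
        · exact integrable_abs_leftCross_sub_rightCross E
        · exact (integrable_leftCross M).add (integrable_rightCross M)
    _ = (2 * α + 1) * cost M := by rw [integral_leftCross_add_rightCross]

theorem excess_le_of_leftCross_le (hα : 0 ≤ α) {n : ℕ} (h : leftCross E y ≤ n) :
    excess α E y ≤ n :=
  (sub_le_self _ (mul_nonneg hα (abs_nonneg _))).trans
    ((min_le_left _ _).trans (Nat.cast_le.mpr h))

theorem excess_le_of_rightCross_le (hα : 0 ≤ α) {n : ℕ} (h : rightCross E y ≤ n) :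
    excess α E y ≤ n :=
  (sub_le_self _ (mul_nonneg hα (abs_nonneg _))).trans
    ((min_le_right _ _).trans (Nat.cast_le.mpr h))

theorem excess_le_of_rightCross_le_of_le_leftCross (hα : 0 ≤ α) {m n : ℕ}
    (hr : rightCross E y ≤ m) (hl : n ≤ leftCross E y) :
    excess α E y ≤ m - α * (max (m : ℝ) n - m) := by
  have hr' : (rightCross E y : ℝ) ≤ m := mod_cast hr
  have hl' : (n : ℝ) ≤ leftCross E y := mod_cast hl
  have hnet : max (m : ℝ) n - m ≤ |(leftCross E y : ℝ) - rightCross E y| := by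
    rw [sub_le_iff_le_add]
    exact max_le (by linarith [abs_nonneg ((leftCross E y : ℝ) - rightCross E y)])
      (by linarith [le_abs_self ((leftCross E y : ℝ) - rightCross E y)])
  exact sub_le_sub ((min_le_right _ _).trans hr') (mul_le_mul_of_nonneg_left hnet hα)

theorem excess_le_of_leftCross_le_of_le_rightCross (hα : 0 ≤ α) {m n : ℕ}
    (hl : leftCross E y ≤ m) (hr : n ≤ rightCross E y) :
    excess α E y ≤ m - α * (max (m : ℝ) n - m) := by
  have hl' : (leftCross E y : ℝ) ≤ m := mod_cast hl
  have hr' : (n : ℝ) ≤ rightCross E y := mod_cast hr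
  have hnet : max (m : ℝ) n - m ≤ |(leftCross E y : ℝ) - rightCross E y| := by
    rw [sub_le_iff_le_add]
    exact max_le (by linarith [abs_nonneg ((leftCross E y : ℝ) - rightCross E y)])
      (by linarith [neg_abs_le ((leftCross E y : ℝ) - rightCross E y)])
  exact sub_le_sub ((min_le_left _ _).trans hl') (mul_le_mul_of_nonneg_left hnet hα)

theorem integral_excess_le_of_forall_le {C : ℝ} (hpq : p ≤ q)
    (h : ∀ y ∈ Set.Ioo p q, excess α E y ≤ C) : ∫ y in p..q, excess α E y ≤ C * (q - p) := by
  calc ∫ y in p..q, excess α E y ≤ ∫ _ in p..q, C :=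
        intervalIntegral.integral_mono_on_of_le_Ioo hpq (intervalIntegrable_excess α E p q)
          intervalIntegrable_const h
    _ = C * (q - p) := by simp [mul_comm]

theorem integral_excess_nonpos_of_intervalIntegral (hα : 0 ≤ α) (hpq : p ≤ q)
    (hsrv : ∀ e ∈ E, p ≤ e.2 ∧ e.2 ≤ q) (h : ∫ y in p..q, excess α E y ≤ 0) :
    ∫ y, excess α E y ≤ 0 := by
  have houtside y (hy : y ∈ (Set.Ioc p q)ᶜ) : excess α E y ≤ 0 := by
    rcases le_or_gt y p with hyp | hpy
    · have hleft : leftCross E y = 0 := List.countP_eq_zero.mpr fun e he => by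
        simpa using fun hlt : e.2 < y => absurd (hyp.trans (hsrv e he).1) hlt.not_ge
      exact mod_cast excess_le_of_leftCross_le hα hleft.le
    · have hqy : q < y := lt_of_not_ge fun hyq => hy ⟨hpy, hyq⟩
      have hright : rightCross E y = 0 := List.countP_eq_zero.mpr fun e he => by
        simpa using fun _ : e.1 < y => (hsrv e he).2.trans_lt hqy
      exact mod_cast excess_le_of_rightCross_le hα hright.le
  rw [intervalIntegral.integral_of_le hpq] at h
  rw [← integral_add_compl measurableSet_Ioc (integrable_excess α E)]
  exact add_nonpos h (setIntegral_nonpos measurableSet_Ioc.compl houtside)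

end Crossing

section Overflow

variable {E : Matching} {α κ p q u v : ℝ}

/-- The larger one of the number of requests left of `q` that are served beyond `q` and the number
of requests right of `p` that are served beyond `p`: an upper bound on the demand for the servers
in `[p, q]` that is served on either side of them. -/
noncomputable def overflow (E : Matching) (p q : ℝ) : ℕ :=
  max (E.countP fun e => e.1 < q ∧ q < e.2) (E.countP fun e => p < e.1 ∧ e.2 < p)

theorem overflow_eq_zero (h : ∀ e ∈ E, p ≤ e.2 ∧ e.2 ≤ q) : overflow E p q = 0 := by
  simp only [overflow, Nat.max_eq_zero_iff, List.countP_eq_zero, decide_eq_true_eq]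
  exact ⟨fun e he hP => (h e he).2.not_gt hP.2, fun e he hP => (h e he).1.not_gt hP.2⟩

theorem integral_excess_eq_add (α : ℝ) (E : Matching) (p u κ v q : ℝ) :
    ∫ y in p..q, excess α E y = (∫ y in p..u, excess α E y) + (∫ y in u..κ, excess α E y) +
      (∫ y in κ..v, excess α E y) + ∫ y in v..q, excess α E y := by
  have hi := intervalIntegrable_excess α E
  rw [intervalIntegral.integral_add_adjacent_intervals (hi _ _) (hi _ _),
    intervalIntegral.integral_add_adjacent_intervals (hi _ _) (hi _ _),
    intervalIntegral.integral_add_adjacent_intervals (hi _ _) (hi _ _)]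

theorem integral_excess_le_of_crit_le_requests (hα : 0 ≤ α) (hpu : p ≤ u) (huκ : u ≤ κ)
    (hκv : κ ≤ v) (hvq : v ≤ q) (hratio : q - κ ≤ α * (κ - u))
    (hgap : ∀ e ∈ E, e.2 ≤ u ∨ v ≤ e.2) (hcrit : ∀ e ∈ E, v ≤ e.2 → e.2 ≤ q → κ ≤ e.1)
    (hleft : ∫ y in p..u, excess α E y ≤ overflow E p u * (u - p))
    (hright : ∫ y in v..q, excess α E y ≤ overflow E v q * (q - v)) :
    ∫ y in p..q, excess α E y ≤ overflow E p q * (q - p) := by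
  set Λ := overflow E p q
  set N := E.countP fun e => κ < e.1 ∧ e.2 ≤ u
  have hover : (E.countP fun e => e.1 < κ ∧ u < e.2) ≤ Λ := by
    refine (countP_le_countP_of_imp fun e he hP => ?_).trans (le_max_left _ _)
    have hv : v ≤ e.2 := (hgap e he).resolve_left hP.2.not_ge
    have hq : q < e.2 := not_le.mp fun hq => (hcrit e he hv hq).not_gt hP.1
    exact ⟨by linarith [hP.1], hq⟩
  have hΛl : overflow E p u ≤ Λ := max_le
    ((countP_le_countP_of_imp fun e _ hP => ⟨hP.1.trans_le huκ, hP.2⟩).trans hover)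
    (le_max_right _ _)
  have hΛr : overflow E v q ≤ max Λ N := max_le ((le_max_left _ _).trans (le_max_left _ _))
    ((countP_le_countP_of_imp fun e he hP =>
      ⟨hκv.trans_lt hP.1, (hgap e he).resolve_right hP.2.not_ge⟩).trans (le_max_right _ _))
  have huκ_int := integral_excess_le_of_forall_le (E := E) huκ fun y hy =>
    excess_le_of_rightCross_le_of_le_leftCross (m := Λ) (n := N) hα
      ((countP_le_countP_of_imp fun e _ hP =>
        ⟨hP.1.trans hy.2, hy.1.trans_le hP.2⟩).trans hover)
      (countP_le_countP_of_imp fun e _ hP => ⟨hP.2.trans_lt hy.1, (hy.2.trans hP.1).le⟩)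
  have hκv_int := integral_excess_le_of_forall_le (E := E) hκv fun y hy =>
    excess_le_of_leftCross_le (n := max Λ N) hα ((countP_le_countP_of_imp fun e he hP =>
      ⟨hy.1.trans_le hP.2, (hgap e he).resolve_right (hP.1.trans hy.2).not_ge⟩).trans
      (le_max_right _ _))
  have hΛl' : (overflow E p u : ℝ) ≤ Λ := mod_cast hΛl
  have hΛr' : (overflow E v q : ℝ) ≤ max (Λ : ℝ) N := mod_cast hΛr
  have hleft' := hleft.trans (mul_le_mul_of_nonneg_right hΛl' (sub_nonneg.mpr hpu))
  have hright' := hright.trans (mul_le_mul_of_nonneg_right hΛr' (sub_nonneg.mpr hvq))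
  -- What the additional overflow `max Λ N - Λ` costs on `[κ, q]` is gained on `[u, κ]`, where it
  -- is net flow.
  have hgain : 0 ≤ (max (Λ : ℝ) N - Λ) * (α * (κ - u) - (q - κ)) :=
    mul_nonneg (sub_nonneg.mpr (le_max_left _ _)) (sub_nonneg.mpr hratio)
  rw [integral_excess_eq_add α E p u κ v q]
  push_cast at hκv_int
  linarith

theorem integral_excess_le_of_requests_le_crit (hα : 0 ≤ α) (hpu : p ≤ u) (huκ : u ≤ κ)
    (hκv : κ ≤ v) (hvq : v ≤ q) (hratio : κ - p ≤ α * (v - κ))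
    (hgap : ∀ e ∈ E, e.2 ≤ u ∨ v ≤ e.2) (hcrit : ∀ e ∈ E, p ≤ e.2 → e.2 ≤ u → e.1 ≤ κ)
    (hleft : ∫ y in p..u, excess α E y ≤ overflow E p u * (u - p))
    (hright : ∫ y in v..q, excess α E y ≤ overflow E v q * (q - v)) :
    ∫ y in p..q, excess α E y ≤ overflow E p q * (q - p) := by
  set Λ := overflow E p q
  set N := E.countP fun e => e.1 < κ ∧ v ≤ e.2
  have hover : (E.countP fun e => κ < e.1 ∧ e.2 < v) ≤ Λ := by
    refine (countP_le_countP_of_imp fun e he hP => ?_).trans (le_max_right _ _)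
    have hu : e.2 ≤ u := (hgap e he).resolve_right hP.2.not_ge
    have hp : e.2 < p := not_le.mp fun hp => (hcrit e he hp hu).not_gt hP.1
    exact ⟨by linarith [hP.1], hp⟩
  have hΛr : overflow E v q ≤ Λ := max_le (le_max_left _ _)
    ((countP_le_countP_of_imp fun e _ hP => ⟨hκv.trans_lt hP.1, hP.2⟩).trans hover)
  have hΛl : overflow E p u ≤ max Λ N := max_le
    ((countP_le_countP_of_imp fun e he hP =>
      ⟨hP.1.trans_le huκ, (hgap e he).resolve_left hP.2.not_ge⟩).trans (le_max_right _ _))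
    ((le_max_right _ _).trans (le_max_left _ _))
  have hκv_int := integral_excess_le_of_forall_le (E := E) hκv fun y hy =>
    excess_le_of_leftCross_le_of_le_rightCross (m := Λ) (n := N) hα
      ((countP_le_countP_of_imp fun e _ hP =>
        ⟨hy.1.trans_le hP.2, hP.1.trans hy.2⟩).trans hover)
      (countP_le_countP_of_imp fun e _ hP => ⟨hP.1.trans hy.1, hy.2.le.trans hP.2⟩)
  have huκ_int := integral_excess_le_of_forall_le (E := E) huκ fun y hy =>
    excess_le_of_rightCross_le (n := max Λ N) hα ((countP_le_countP_of_imp fun e he hP =>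
      ⟨hP.1.trans hy.2, (hgap e he).resolve_left (hy.1.trans_le hP.2).not_ge⟩).trans
      (le_max_right _ _))
  have hΛl' : (overflow E p u : ℝ) ≤ max (Λ : ℝ) N := mod_cast hΛl
  have hΛr' : (overflow E v q : ℝ) ≤ Λ := mod_cast hΛr
  have hleft' := hleft.trans (mul_le_mul_of_nonneg_right hΛl' (sub_nonneg.mpr hpu))
  have hright' := hright.trans (mul_le_mul_of_nonneg_right hΛr' (sub_nonneg.mpr hvq))
  have hgain : 0 ≤ (max (Λ : ℝ) N - Λ) * (α * (v - κ) - (κ - p)) :=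
    mul_nonneg (sub_nonneg.mpr (le_max_left _ _)) (sub_nonneg.mpr hratio)
  rw [integral_excess_eq_add α E p u κ v q]
  push_cast at huκ_int
  linarith

end Overflow

section SplitRule

variable (g : SplitRule) {T F : Finset ℝ} {α p q r : ℝ}

/-- The critical point of the chosen largest gap: PTCP prefers the servers left of the gap exactly
for the requests up to this point. -/
noncomputable def SplitRule.crit (g : SplitRule) (T : Finset ℝ) (h : 2 ≤ T.card) : ℝ :=
  g.left T + g.offset T h

theorem SplitRule.S₁_subset (T : Finset ℝ) : g.S₁ T ⊆ T := Finset.filter_subset _ _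

theorem SplitRule.S₂_subset (T : Finset ℝ) : g.S₂ T ⊆ T := Finset.filter_subset _ _

theorem SplitRule.disjoint_S₁_S₂ (h : 2 ≤ T.card) : Disjoint (g.S₁ T) (g.S₂ T) := by
  obtain ⟨⟨-, -, huv, -⟩, -⟩ := g.isMaxGap T h
  exact Finset.disjoint_filter.mpr fun s _ hu => not_le.mpr (hu.trans_lt huv)

theorem SplitRule.mem_S₁_or_mem_S₂ (h : 2 ≤ T.card) {s : ℝ} (hs : s ∈ T) :
    s ∈ g.S₁ T ∨ s ∈ g.S₂ T := by
  obtain ⟨⟨-, -, -, hadj⟩, -⟩ := g.isMaxGap T h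
  simp only [SplitRule.S₁, SplitRule.S₂, Finset.mem_filter, hs, true_and]
  by_contra! hgap
  exact hadj s hs hgap

theorem ptcpServer_singleton (T : Finset ℝ) (r s : ℝ) : ptcpServer g T r {s} = s := by
  have hs : ∃ t, ({s} : Finset ℝ) = {t} := ⟨s, rfl⟩
  rw [ptcpServer, dif_pos hs]
  exact (Finset.singleton_inj.mp hs.choose_spec).symm

theorem ptcpServer_eq_S₁_or_eq_S₂ (h : 2 ≤ T.card) (hF : F ⊆ T) (hne : F.Nonempty) :
    (ptcpServer g T r F = ptcpServer g (g.S₁ T) r (F ∩ g.S₁ T) ∧ ptcpServer g T r F ∈ g.S₁ T ∧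
      (r ≤ g.crit T h ∨ F ∩ g.S₂ T = ∅)) ∨
    (ptcpServer g T r F = ptcpServer g (g.S₂ T) r (F ∩ g.S₂ T) ∧ ptcpServer g T r F ∈ g.S₂ T ∧
      (g.crit T h ≤ r ∨ F ∩ g.S₁ T = ∅)) := by
  have hdisj := g.disjoint_S₁_S₂ h
  by_cases hs : ∃ s, F = {s}
  · obtain ⟨s, rfl⟩ := hs
    rcases g.mem_S₁_or_mem_S₂ h (hF (Finset.mem_singleton_self s)) with hs | hs
    · left
      simp [ptcpServer_singleton, hs, Finset.disjoint_left.mp hdisj hs]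
    · right
      simp [ptcpServer_singleton, hs, Finset.disjoint_right.mp hdisj hs]
  have hmem (U : Finset ℝ) (hU : (F ∩ U).Nonempty) : ptcpServer g U r (F ∩ U) ∈ U :=
    (Finset.mem_inter.mp (ptcpServer_mem g r _ _ Finset.inter_subset_right hU)).2
  rw [ptcpServer, dif_neg hs, dif_pos h]
  split_ifs with hbranch
  · refine .inl ⟨rfl, hmem _ ?_, hbranch.imp And.left id⟩
    rcases hbranch with hbranch | hempty
    · exact hbranch.2
    · obtain ⟨s, hs⟩ := hne
      refine ⟨s, Finset.mem_inter.mpr ⟨hs, (g.mem_S₁_or_mem_S₂ h (hF hs)).resolve_right ?_⟩⟩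
      exact fun hs₂ => Finset.notMem_empty s (hempty ▸ Finset.mem_inter.mpr ⟨hs, hs₂⟩)
  · rw [not_or, not_and_or, Finset.not_nonempty_iff_eq_empty] at hbranch
    exact .inr ⟨rfl, hmem _ (Finset.nonempty_iff_ne_empty.mpr hbranch.2),
      hbranch.1.imp_left fun hr => (not_le.mp hr).le⟩

theorem ptcpServer_of_mem_S₁ (h : 2 ≤ T.card) (hF : F ⊆ T) (hne : F.Nonempty)
    (hmem : ptcpServer g T r F ∈ g.S₁ T) :
    ptcpServer g T r F = ptcpServer g (g.S₁ T) r (F ∩ g.S₁ T) ∧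
      (r ≤ g.crit T h ∨ F ∩ g.S₂ T = ∅) := by
  rcases ptcpServer_eq_S₁_or_eq_S₂ g h hF hne with ⟨heq, -, hr⟩ | ⟨-, hmem', -⟩
  · exact ⟨heq, hr⟩
  · exact absurd hmem' (Finset.disjoint_left.mp (g.disjoint_S₁_S₂ h) hmem)

theorem ptcpServer_of_mem_S₂ (h : 2 ≤ T.card) (hF : F ⊆ T) (hne : F.Nonempty)
    (hmem : ptcpServer g T r F ∈ g.S₂ T) :
    ptcpServer g T r F = ptcpServer g (g.S₂ T) r (F ∩ g.S₂ T) ∧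
      (g.crit T h ≤ r ∨ F ∩ g.S₁ T = ∅) := by
  rcases ptcpServer_eq_S₁_or_eq_S₂ g h hF hne with ⟨-, hmem', -⟩ | ⟨heq, -, hr⟩
  · exact absurd hmem' (Finset.disjoint_right.mp (g.disjoint_S₁_S₂ h) hmem)
  · exact ⟨heq, hr⟩

theorem SplitRule.crit_eq (h : 2 ≤ T.card) (hp : IsLeast (T : Set ℝ) p)
    (hq : IsGreatest (T : Set ℝ) q) :
    g.crit T h = g.left T +
      (q - g.left T) / ((g.right T - p) + (q - g.left T)) * (g.right T - g.left T) := by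
  simp only [SplitRule.crit, SplitRule.offset, (T.isLeast_min' _).unique hp,
    (T.isGreatest_max' _).unique hq]
  ring_nf

theorem SplitRule.left_le_crit (h : 2 ≤ T.card) : g.left T ≤ g.crit T h := by
  obtain ⟨⟨hu, hv, huv, -⟩, -⟩ := g.isMaxGap T h
  have hp := T.min'_le _ hv
  have hq := T.le_max' _ hu
  rw [g.crit_eq h (T.isLeast_min' ⟨_, hu⟩) (T.isGreatest_max' ⟨_, hv⟩), le_add_iff_nonneg_right]
  exact mul_nonneg (div_nonneg (by linarith) (by linarith)) (by linarith)

theorem SplitRule.crit_le_right (h : 2 ≤ T.card) : g.crit T h ≤ g.right T := by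
  obtain ⟨⟨hu, hv, huv, -⟩, -⟩ := g.isMaxGap T h
  have hp := T.min'_le _ hv
  have hq := T.le_max' _ hu
  rw [g.crit_eq h (T.isLeast_min' ⟨_, hu⟩) (T.isGreatest_max' ⟨_, hv⟩), ← le_sub_iff_add_le']
  exact mul_le_of_le_one_left (by linarith) (div_le_one_of_le₀ (by linarith) (by linarith))

theorem SplitRule.sub_crit_mul_gap (h : 2 ≤ T.card) (hp : IsLeast (T : Set ℝ) p)
    (hq : IsGreatest (T : Set ℝ) q) :
    (q - g.crit T h) * (g.right T - g.left T) = (q - p) * (g.crit T h - g.left T) := by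
  obtain ⟨⟨hu, -, huv, -⟩, -⟩ := g.isMaxGap T h
  have hden : g.right T - p + (q - g.left T) ≠ 0 := by linarith [hp.2 hu, hq.2 hu]
  rw [g.crit_eq h hp hq]
  field_simp
  ring

theorem SplitRule.crit_sub_mul_gap (h : 2 ≤ T.card) (hp : IsLeast (T : Set ℝ) p)
    (hq : IsGreatest (T : Set ℝ) q) :
    (g.crit T h - p) * (g.right T - g.left T) = (q - p) * (g.right T - g.crit T h) := by
  linear_combination -g.sub_crit_mul_gap h hp hq

theorem SplitRule.sub_crit_le (h : 2 ≤ T.card) (hp : IsLeast (T : Set ℝ) p)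
    (hq : IsGreatest (T : Set ℝ) q) (hα : q - p ≤ α * (g.right T - g.left T)) :
    q - g.crit T h ≤ α * (g.crit T h - g.left T) := by
  have hgap : 0 < g.right T - g.left T := sub_pos.mpr (g.isMaxGap T h).1.2.2.1
  refine le_of_mul_le_mul_right ?_ hgap
  rw [g.sub_crit_mul_gap h hp hq, mul_right_comm]
  exact mul_le_mul_of_nonneg_right hα (sub_nonneg.mpr (g.left_le_crit h))

theorem SplitRule.crit_sub_le (h : 2 ≤ T.card) (hp : IsLeast (T : Set ℝ) p)
    (hq : IsGreatest (T : Set ℝ) q) (hα : q - p ≤ α * (g.right T - g.left T)) :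
    g.crit T h - p ≤ α * (g.right T - g.crit T h) := by
  have hgap : 0 < g.right T - g.left T := sub_pos.mpr (g.isMaxGap T h).1.2.2.1
  refine le_of_mul_le_mul_right ?_ hgap
  rw [g.crit_sub_mul_gap h hp hq, mul_right_comm]
  exact mul_le_mul_of_nonneg_right hα (sub_nonneg.mpr (g.crit_le_right h))

end SplitRule

section Alpha

variable {S T : Finset ℝ} {p q u v : ℝ}

theorem IsAdjacent.le_maxGap (h : IsAdjacent T u v) : v - u ≤ maxGap T := by
  refine le_csSup ?_ ⟨u, v, h, rfl⟩
  refine (((T ×ˢ T).image fun x : ℝ × ℝ => x.2 - x.1).finite_toSet.subset ?_).bddAbove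
  rintro _ ⟨u, v, h, rfl⟩
  exact Finset.mem_image_of_mem (fun x : ℝ × ℝ => x.2 - x.1) (Finset.mk_mem_product h.1 h.2.1)

theorem IsMaxGap.maxGap_eq (h : IsMaxGap T u v) : maxGap T = v - u :=
  le_antisymm (csSup_le ⟨_, u, v, h.1, rfl⟩ (by rintro _ ⟨u', v', h', rfl⟩; exact h.2 u' v' h'))
    h.1.le_maxGap

theorem IsAdjacent.two_le_card (h : IsAdjacent T u v) : 2 ≤ T.card :=
  Finset.one_lt_card.mpr ⟨u, h.1, v, h.2.1, h.2.2.1.ne⟩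

theorem IsMaxGap.L_eq (h : IsMaxGap T u v) (hp : IsLeast (T : Set ℝ) p)
    (hq : IsGreatest (T : Set ℝ) q) : L T = (q - p) / (v - u) := by
  rw [L, dif_pos h.1.two_le_card, h.maxGap_eq, (T.isLeast_min' _).unique hp,
    (T.isGreatest_max' _).unique hq]

theorem L_le_alpha (h : T ⊆ S) : L T ≤ alpha S := Finset.le_sup' L (Finset.mem_powerset.mpr h)

theorem alpha_nonneg (S : Finset ℝ) : 0 ≤ alpha S := by
  simpa [L] using L_le_alpha (Finset.empty_subset S)

theorem IsMaxGap.sub_le_alpha_mul (h : IsMaxGap T u v) (hTS : T ⊆ S)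
    (hp : IsLeast (T : Set ℝ) p) (hq : IsGreatest (T : Set ℝ) q) :
    q - p ≤ alpha S * (v - u) := by
  rw [← div_le_iff₀ (sub_pos.mpr h.1.2.2.1), ← h.L_eq hp hq]
  exact L_le_alpha hTS

end Alpha

section Ptcp

variable {g : SplitRule} {S T : Finset ℝ} {c : ℝ → ℕ} {E : Matching} {p q : ℝ}

/-- On the servers in `T`, the matching `E` arises under the rule of PTCP for the server set
`T`. -/
def FollowsPtcp (g : SplitRule) (S : Finset ℝ) (c : ℝ → ℕ) (T : Finset ℝ) (E : Matching) : Prop :=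
  FollowsOn S c T (fun M r => ptcpServer g T r (free S c M ∩ T)) E

theorem FollowsPtcp.ptcpServer_S₁ (hE : FollowsPtcp g S c T E) (h : 2 ≤ T.card) {r a : ℝ}
    {M : Matching} (hM : (r, a) :: M <:+ E) (ha : a ∈ g.S₁ T) :
    a = ptcpServer g (g.S₁ T) r (free S c M ∩ g.S₁ T) ∧
      (r ≤ g.crit T h ∨ free S c M ∩ g.S₂ T = ∅) := by
  have haT := g.S₁_subset T ha
  have hchoice : a = ptcpServer g T r (free S c M ∩ T) := (hE r a M hM).2 haT
  have hserver := ptcpServer_of_mem_S₁ (r := r) g h Finset.inter_subset_right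
    ⟨a, Finset.mem_inter.mpr ⟨(hE r a M hM).1, haT⟩⟩ (hchoice ▸ ha)
  rwa [← hchoice, Finset.inter_assoc, Finset.inter_assoc, Finset.inter_eq_right.mpr (g.S₁_subset T),
    Finset.inter_eq_right.mpr (g.S₂_subset T)] at hserver

theorem FollowsPtcp.ptcpServer_S₂ (hE : FollowsPtcp g S c T E) (h : 2 ≤ T.card) {r a : ℝ}
    {M : Matching} (hM : (r, a) :: M <:+ E) (ha : a ∈ g.S₂ T) :
    a = ptcpServer g (g.S₂ T) r (free S c M ∩ g.S₂ T) ∧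
      (g.crit T h ≤ r ∨ free S c M ∩ g.S₁ T = ∅) := by
  have haT := g.S₂_subset T ha
  have hchoice : a = ptcpServer g T r (free S c M ∩ T) := (hE r a M hM).2 haT
  have hserver := ptcpServer_of_mem_S₂ (r := r) g h Finset.inter_subset_right
    ⟨a, Finset.mem_inter.mpr ⟨(hE r a M hM).1, haT⟩⟩ (hchoice ▸ ha)
  rwa [← hchoice, Finset.inter_assoc, Finset.inter_assoc, Finset.inter_eq_right.mpr (g.S₁_subset T),
    Finset.inter_eq_right.mpr (g.S₂_subset T)] at hserver

theorem FollowsPtcp.S₁ (hE : FollowsPtcp g S c T E) (h : 2 ≤ T.card) :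
    FollowsPtcp g S c (g.S₁ T) E := fun r a M hM =>
  ⟨(hE r a M hM).1, fun ha => (hE.ptcpServer_S₁ h hM ha).1⟩

theorem FollowsPtcp.S₂ (hE : FollowsPtcp g S c T E) (h : 2 ≤ T.card) :
    FollowsPtcp g S c (g.S₂ T) E := fun r a M hM =>
  ⟨(hE r a M hM).1, fun ha => (hE.ptcpServer_S₂ h hM ha).1⟩

/-- Requests overflow the critical point in at most one direction: such a request finds no free
server on its own side, and servers never become free again. -/
theorem FollowsPtcp.crit_le_or_le_crit (hE : FollowsPtcp g S c T E) (h : 2 ≤ T.card) :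
    (∀ e ∈ E, e.2 ∈ g.S₂ T → g.crit T h ≤ e.1) ∨
      ∀ e ∈ E, e.2 ∈ g.S₁ T → e.1 ≤ g.crit T h := by
  by_contra! hboth
  obtain ⟨⟨⟨r, a⟩, he, ha, hr⟩, ⟨⟨r', a'⟩, he', ha', hr'⟩⟩ := hboth
  obtain ⟨l, M, hl⟩ := List.append_of_mem he
  obtain ⟨l', M', hl'⟩ := List.append_of_mem he'
  have hM : (r, a) :: M <:+ E := ⟨l, hl.symm⟩
  have hM' : (r', a') :: M' <:+ E := ⟨l', hl'.symm⟩
  have hfull := (hE.ptcpServer_S₂ h hM ha).2.resolve_left hr.not_ge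
  have hfull' := (hE.ptcpServer_S₁ h hM' ha').2.resolve_left hr'.not_ge
  rcases List.suffix_or_suffix_of_suffix ((List.suffix_cons _ _).trans hM)
    ((List.suffix_cons _ _).trans hM') with hMM' | hM'M
  · refine Finset.notMem_empty a' (hfull ▸ Finset.mem_inter.mpr ⟨?_, ha'⟩)
    exact free_subset_of_isSuffix hMM' (hE r' a' M' hM').1
  · refine Finset.notMem_empty a (hfull' ▸ Finset.mem_inter.mpr ⟨?_, ha⟩)
    exact free_subset_of_isSuffix hM'M (hE r a M hM).1

theorem followsPtcp_runFrom_ptcp {σ : List ℝ} (h : σ.length ≤ ∑ s ∈ S, c s) :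
    FollowsPtcp g S c S ((ptcp g S c).runFrom [] σ) := by
  intro r a M hM
  have hrun := followsOn_runFrom (A := ptcp g S c) followsOn_nil (by simpa using h) r a M hM
  refine ⟨hrun.1, fun haS => ?_⟩
  change a = ptcpServer g S r (free S c M ∩ S)
  rw [Finset.inter_eq_left.mpr (show free S c M ⊆ S from Finset.filter_subset _ _)]
  exact hrun.2 haS

/-- `T` consists of the servers of `S` in `[p, q]`, the end points of which belong to `T`. -/
structure IsSegment (S T : Finset ℝ) (p q : ℝ) : Prop where
  left_mem : p ∈ T
  right_mem : q ∈ T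
  mem_iff : ∀ s, s ∈ T ↔ s ∈ S ∧ p ≤ s ∧ s ≤ q

theorem IsSegment.subset (hT : IsSegment S T p q) : T ⊆ S := fun s hs => ((hT.mem_iff s).mp hs).1

theorem IsSegment.isLeast (hT : IsSegment S T p q) : IsLeast (T : Set ℝ) p :=
  ⟨hT.left_mem, fun s hs => ((hT.mem_iff s).mp hs).2.1⟩

theorem IsSegment.isGreatest (hT : IsSegment S T p q) : IsGreatest (T : Set ℝ) q :=
  ⟨hT.right_mem, fun s hs => ((hT.mem_iff s).mp hs).2.2⟩

theorem isSegment_min'_max' (hS : S.Nonempty) : IsSegment S S (S.min' hS) (S.max' hS) :=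
  ⟨S.min'_mem hS, S.max'_mem hS, fun s =>
    ⟨fun hs => ⟨hs, S.min'_le s hs, S.le_max' s hs⟩, And.left⟩⟩

theorem IsSegment.S₁ (hT : IsSegment S T p q) (h : 2 ≤ T.card) :
    IsSegment S (g.S₁ T) p (g.left T) := by
  obtain ⟨⟨hu, -, -, -⟩, -⟩ := g.isMaxGap T h
  refine ⟨Finset.mem_filter.mpr ⟨hT.left_mem, hT.isLeast.2 hu⟩,
    Finset.mem_filter.mpr ⟨hu, le_rfl⟩, fun s => ?_⟩
  have huq : g.left T ≤ q := hT.isGreatest.2 hu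
  rw [SplitRule.S₁, Finset.mem_filter, hT.mem_iff]
  exact ⟨fun hs => ⟨hs.1.1, hs.1.2.1, hs.2⟩, fun hs => ⟨⟨hs.1, hs.2.1, hs.2.2.trans huq⟩, hs.2.2⟩⟩

theorem IsSegment.S₂ (hT : IsSegment S T p q) (h : 2 ≤ T.card) :
    IsSegment S (g.S₂ T) (g.right T) q := by
  obtain ⟨⟨-, hv, -, -⟩, -⟩ := g.isMaxGap T h
  refine ⟨Finset.mem_filter.mpr ⟨hv, le_rfl⟩,
    Finset.mem_filter.mpr ⟨hT.right_mem, hT.isGreatest.2 hv⟩, fun s => ?_⟩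
  have hpv : p ≤ g.right T := hT.isLeast.2 hv
  rw [SplitRule.S₂, Finset.mem_filter, hT.mem_iff]
  exact ⟨fun hs => ⟨hs.1.1, hs.2, hs.1.2.2⟩, fun hs => ⟨⟨hs.1, hpv.trans hs.2.1, hs.2.2⟩, hs.2.1⟩⟩

theorem IsSegment.le_left_or_right_le (hT : IsSegment S T p q) (h : 2 ≤ T.card) {s : ℝ}
    (hs : s ∈ S) : s ≤ g.left T ∨ g.right T ≤ s := by
  obtain ⟨⟨hu, hv, -, hadj⟩, -⟩ := g.isMaxGap T h
  by_contra! hgap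
  have hsT : s ∈ T := (hT.mem_iff s).mpr
    ⟨hs, (hT.isLeast.2 hu).trans hgap.1.le, hgap.2.le.trans (hT.isGreatest.2 hv)⟩
  exact hadj s hsT hgap

theorem FollowsPtcp.integral_excess_le (hE : FollowsPtcp g S c T E) (hT : IsSegment S T p q) :
    ∫ y in p..q, excess (alpha S) E y ≤ overflow E p q * (q - p) := by
  induction hn : T.card using Nat.strong_induction_on generalizing T p q with
  | _ n ih =>
  subst hn
  have hp := hT.isLeast
  have hq := hT.isGreatest
  rcases lt_or_ge T.card 2 with hcard | h
  · obtain rfl : p = q := Finset.card_le_one.mp (by omega) p hp.1 q hq.1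
    simp
  have hgap := g.isMaxGap T h
  have hα := hgap.sub_le_alpha_mul hT.subset hp hq
  have hleft := ih _ (g.card_S₁_lt h) (hE.S₁ h) (hT.S₁ h) rfl
  have hright := ih _ (g.card_S₂_lt h) (hE.S₂ h) (hT.S₂ h) rfl
  have hsrv e (he : e ∈ E) : e.2 ≤ g.left T ∨ g.right T ≤ e.2 :=
    hT.le_left_or_right_le h (hE.mem e he)
  have hpu := hp.2 hgap.1.1
  have hvq := hq.2 hgap.1.2.1
  rcases hE.crit_le_or_le_crit h with hcrit | hcrit
  · refine integral_excess_le_of_crit_le_requests (alpha_nonneg S) hpu (g.left_le_crit h)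
      (g.crit_le_right h) hvq (g.sub_crit_le h hp hq hα) hsrv ?_ hleft hright
    exact fun e he hve heq => hcrit e he (((hT.S₂ h).mem_iff _).mpr ⟨hE.mem e he, hve, heq⟩)
  · refine integral_excess_le_of_requests_le_crit (alpha_nonneg S) hpu (g.left_le_crit h)
      (g.crit_le_right h) hvq (g.crit_sub_le h hp hq hα) hsrv ?_ hleft hright
    exact fun e he hpe heu => hcrit e he (((hT.S₁ h).mem_iff _).mpr ⟨hE.mem e he, hpe, heu⟩)

theorem FollowsPtcp.integral_excess_nonpos (hE : FollowsPtcp g S c S E) :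
    ∫ y, excess (alpha S) E y ≤ 0 := by
  rcases S.eq_empty_or_nonempty with rfl | hS
  · obtain rfl : E = [] :=
      List.eq_nil_iff_forall_not_mem.mpr fun e he => Finset.notMem_empty _ (hE.mem e he)
    simp [excess, leftCross, rightCross]
  have hsrv e (he : e ∈ E) : S.min' hS ≤ e.2 ∧ e.2 ≤ S.max' hS :=
    ⟨S.min'_le _ (hE.mem e he), S.le_max' _ (hE.mem e he)⟩
  refine integral_excess_nonpos_of_intervalIntegral (alpha_nonneg S) (S.min'_le_max' hS) hsrv ?_
  simpa [overflow_eq_zero hsrv] using hE.integral_excess_le (isSegment_min'_max' hS)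

/-- Requests at free servers cost the optimal matching nothing and PTCP no less than nothing, so all
capacity may be assumed to be used up. -/
theorem isCompetitive_ptcp (g : SplitRule) (S : Finset ℝ) (c : ℝ → ℕ) :
    (ptcp g S c).IsCompetitive (2 * alpha S + 1) := by
  have hα := alpha_nonneg S
  refine isCompetitive_of_forall_isFeasible (by linarith) fun σ M hM => ?_
  obtain ⟨τ, hlen, hfull⟩ := hM.exists_append_diagonal
  have hrun := isFeasible_runFrom_nil (ptcp g S c) hlen.le
  have hexcess := (followsPtcp_runFrom_ptcp (g := g) hlen.le).integral_excess_nonpos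
  calc (ptcp g S c).totalCost σ ≤ (ptcp g S c).totalCost (σ ++ τ) :=
        totalCost_le_totalCost_append _ σ τ
    _ ≤ (2 * alpha S + 1) * cost (diagonal τ ++ M) :=
        cost_le_of_integral_excess_nonpos hα hexcess (hrun.1.trans hfull.1.symm)
          (hrun.perm_servers hfull hlen)
    _ = (2 * alpha S + 1) * cost M := by rw [cost_append, cost_diagonal, zero_add]

end Ptcp

section Layout

variable {T : Finset ℝ} {k : ℕ} {s t v : ℝ}

theorem exists_isAdjacent_of_lt (hs : s ∈ T) (hv : v ∈ T) (hsv : s < v) :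
    ∃ u, IsAdjacent T u v := by
  have hne : (T.filter (· < v)).Nonempty := ⟨s, Finset.mem_filter.mpr ⟨hs, hsv⟩⟩
  obtain ⟨hu, huv⟩ := Finset.mem_filter.mp ((T.filter (· < v)).max'_mem hne)
  refine ⟨_, hu, hv, huv, fun t ht hgap => hgap.1.not_ge ?_⟩
  exact Finset.le_max' _ _ (Finset.mem_filter.mpr ⟨ht, hgap.2⟩)

theorem L_le_two_of_two_mul_le (hnonneg : ∀ s ∈ T, 0 ≤ s)
    (hdouble : ∀ s ∈ T, ∀ t ∈ T, s < t → 2 * s ≤ t) : L T ≤ 2 := by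
  rw [L]
  split_ifs with h
  · have hp := T.min'_mem (nonempty_of_two_le h)
    have hv := T.max'_mem (nonempty_of_two_le h)
    obtain ⟨u, huv⟩ := exists_isAdjacent_of_lt hp hv (T.min'_lt_max'_of_card h)
    have hgap := huv.le_maxGap
    rw [div_le_iff₀ ((sub_pos.mpr huv.2.2.1).trans_le hgap)]
    linarith [hnonneg _ hp, hdouble _ huv.1 _ hv huv.2.2.1]
  · exact zero_le_two

theorem serverPos_one : serverPos 1 = 0 := if_pos rfl

theorem serverPos_add_two (m : ℕ) : serverPos (m + 2) = 2 ^ (m + 1) := if_neg (by omega)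

theorem strictMono_serverPos_succ : StrictMono fun i => serverPos (i + 1) := by
  refine strictMono_nat_of_lt_succ fun i => ?_
  rcases i with _ | i
  · simp [serverPos_one, serverPos_add_two]
  · simpa only [serverPos_add_two] using pow_lt_pow_right₀ one_lt_two (Nat.lt_succ_self _)

theorem mem_layout : s ∈ layout k ↔ ∃ i < k, serverPos (i + 1) = s := by
  simp only [layout, Finset.mem_image, Finset.mem_Icc]
  constructor
  · rintro ⟨i, ⟨hi, hik⟩, rfl⟩
    exact ⟨i - 1, by omega, by rw [Nat.sub_add_cancel hi]⟩
  · rintro ⟨i, hik, rfl⟩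
    exact ⟨i + 1, ⟨by omega, hik⟩, rfl⟩

theorem nonneg_of_mem_layout (hs : s ∈ layout k) : 0 ≤ s := by
  obtain ⟨i, -, rfl⟩ := mem_layout.mp hs
  exact serverPos_one ▸ strictMono_serverPos_succ.monotone (Nat.zero_le i)

theorem two_mul_serverPos_le (i : ℕ) : 2 * serverPos (i + 1) ≤ serverPos (i + 2) := by
  rcases i with _ | i
  · simp [serverPos_one, serverPos_add_two]
  · rw [serverPos_add_two, serverPos_add_two, ← pow_succ']

theorem two_mul_le_of_mem_layout (hs : s ∈ layout k) (ht : t ∈ layout k) (hst : s < t) :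
    2 * s ≤ t := by
  obtain ⟨i, -, rfl⟩ := mem_layout.mp hs
  obtain ⟨j, -, rfl⟩ := mem_layout.mp ht
  have hij : i + 1 ≤ j := strictMono_serverPos_succ.lt_iff_lt.mp hst
  exact (two_mul_serverPos_le i).trans (strictMono_serverPos_succ.monotone hij)

theorem alpha_layout_le (k : ℕ) : alpha (layout k) ≤ 2 := by
  refine Finset.sup'_le _ _ fun T hT => L_le_two_of_two_mul_le ?_ ?_
  · exact fun s hs => nonneg_of_mem_layout (Finset.mem_powerset.mp hT hs)
  · exact fun s hs t ht => two_mul_le_of_mem_layout (Finset.mem_powerset.mp hT hs)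
      (Finset.mem_powerset.mp hT ht)

theorem isMaxGap_zero_two_four : IsMaxGap {0, 2, 4} 0 2 := by
  refine ⟨⟨by simp, by simp, by norm_num, fun t ht => ?_⟩, ?_⟩
  · simp only [Finset.mem_insert, Finset.mem_singleton] at ht
    rcases ht with rfl | rfl | rfl <;> norm_num
  · rintro u v ⟨hu, hv, -, hadj⟩
    have hmid := hadj 2 (by simp)
    simp only [Finset.mem_insert, Finset.mem_singleton] at hu hv
    revert hmid
    rcases hu with rfl | rfl | rfl <;> rcases hv with rfl | rfl | rfl <;> norm_num

theorem L_zero_two_four : L {0, 2, 4} = 2 := by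
  rw [isMaxGap_zero_two_four.L_eq (p := 0) (q := 4)]
  · norm_num
  · exact ⟨by simp, by simp⟩
  · exact ⟨by simp, by norm_num [mem_upperBounds]⟩

theorem alpha_layout_eq (hk : 3 ≤ k) : alpha (layout k) = 2 := by
  refine le_antisymm (alpha_layout_le k) (L_zero_two_four ▸ L_le_alpha fun s hs => ?_)
  simp only [Finset.mem_insert, Finset.mem_singleton] at hs
  rcases hs with rfl | rfl | rfl
  · exact mem_layout.mpr ⟨0, by omega, serverPos_one⟩
  · exact mem_layout.mpr ⟨1, by omega, by norm_num [serverPos]⟩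
  · exact mem_layout.mpr ⟨2, by omega, by norm_num [serverPos]⟩

theorem isCompetitive_ptcp_layout (g : SplitRule) (k : ℕ) (c : ℝ → ℕ) :
    (ptcp g (layout k) c).IsCompetitive 5 :=
  isCompetitive_mono (isCompetitive_ptcp g (layout k) c) (by linarith [alpha_layout_le k])

end Layout

section Greedy

variable {S : Finset ℝ} {c : ℝ → ℕ} {M : Matching} {k m n : ℕ} {ε : ℝ}

theorem OnlineAlgorithm.IsGreedy.choose_eq {G : OnlineAlgorithm S c} (hG : G.IsGreedy) {r s : ℝ}
    (hs : s ∈ free S c M) (hnear : ∀ t ∈ free S c M, t ≠ s → |r - s| < |r - t|) :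
    G.choose M r = s := by
  by_contra hne
  exact (hG M r s hs).not_gt (hnear _ (G.choose_mem M r ⟨s, hs⟩) hne)

theorem OnlineAlgorithm.IsGreedy.runFrom_eq_diagonal_append {G : OnlineAlgorithm S c}
    (hG : G.IsGreedy) {τ : List ℝ} (hτ : ∀ s ∈ τ, s ∈ S)
    (hc : ∀ s ∈ S, load M s + τ.count s ≤ c s) : G.runFrom M τ = diagonal τ ++ M := by
  induction τ generalizing M with
  | nil => rfl
  | cons s τ ih =>
    have hs := hτ s List.mem_cons_self
    have hfree : s ∈ free S c M := by
      have := hc s hs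
      rw [List.count_cons_self] at this
      exact mem_free.mpr ⟨hs, by omega⟩
    have hchoose : G.choose M s = s :=
      hG.choose_eq hfree fun t _ hts => by simpa [sub_eq_zero] using hts.symm
    have hload t (ht : t ∈ S) : load ((s, s) :: M) t + τ.count t ≤ c t := by
      have := hc t ht
      rw [List.count_cons] at this
      simp only [load_cons, beq_iff_eq] at this ⊢
      omega
    rw [OnlineAlgorithm.runFrom, hchoose, ih (fun t ht => hτ t (List.mem_cons_of_mem _ ht)) hload]
    simp [diagonal]

/-- The `i`-th request of the sequence that leads a greedy algorithm astray, for `i = 0, 1, …`: it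
lies slightly closer to `2 ^ (i + 1)` than to `0`. -/
def lure (ε : ℝ) (i : ℕ) : ℝ := 2 ^ i + ε

/-- The lures `0, …, n - 1`, in their order of arrival. -/
def lures (ε : ℝ) (n : ℕ) : List ℝ := (List.range n).map (lure ε)

/-- The matching of the first `n` lures that a greedy algorithm makes: each lure goes to the nearest
server to its right. -/
def luredMatching (ε : ℝ) (n : ℕ) : Matching :=
  ((List.range n).map fun i => (lure ε i, (2 : ℝ) ^ (i + 1))).reverse

/-- The servers of `layout k` that remain free when `2 ^ 1, …, 2 ^ i` are full. -/
noncomputable def layoutAbove (k i : ℕ) : Finset ℝ :=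
  insert 0 ((Finset.Ioo i k).image fun j => (2 : ℝ) ^ j)

/-- The matching that serves the `i`-th lure from the server just left of it, which is `0` for
`i = 0` and `2 ^ i` for `i ≥ 1`. -/
noncomputable def shiftedMatching (ε : ℝ) (n : ℕ) : Matching :=
  ((List.range n).map fun i => (lure ε i, serverPos (i + 1))).reverse

theorem lures_succ (ε : ℝ) (n : ℕ) : lures ε (n + 1) = lures ε n ++ [lure ε n] := by
  simp [lures, List.range_succ]

theorem luredMatching_succ (ε : ℝ) (n : ℕ) :
    luredMatching ε (n + 1) = (lure ε n, 2 ^ (n + 1)) :: luredMatching ε n := by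
  simp [luredMatching, List.range_succ]

theorem shiftedMatching_succ (ε : ℝ) (n : ℕ) :
    shiftedMatching ε (n + 1) = (lure ε n, serverPos (n + 1)) :: shiftedMatching ε n := by
  simp [shiftedMatching, List.range_succ]

theorem layout_succ_eq_layoutAbove (m : ℕ) : layout (m + 1) = layoutAbove (m + 1) 0 := by
  ext s
  simp only [mem_layout, layoutAbove, Finset.mem_insert, Finset.mem_image, Finset.mem_Ioo]
  constructor
  · rintro ⟨_ | i, hi, rfl⟩
    · exact .inl serverPos_one
    · exact .inr ⟨i + 1, ⟨by omega, hi⟩, (serverPos_add_two i).symm⟩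
  · rintro (rfl | ⟨_ | i, ⟨hi, him⟩, rfl⟩)
    · exact ⟨0, by omega, serverPos_one⟩
    · omega
    · exact ⟨i + 1, him, serverPos_add_two i⟩

theorem layoutAbove_erase (k i : ℕ) :
    (layoutAbove k i).erase (2 ^ (i + 1)) = layoutAbove k (i + 1) := by
  have hinj : Function.Injective fun j : ℕ => (2 : ℝ) ^ j :=
    pow_right_injective₀ two_pos (by norm_num)
  have hIoo : (Finset.Ioo i k).erase (i + 1) = Finset.Ioo (i + 1) k := by
    ext j
    simp only [Finset.mem_erase, Finset.mem_Ioo]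
    omega
  rw [layoutAbove, Finset.erase_insert_of_ne (by positivity), ← Finset.image_erase hinj, hIoo,
    layoutAbove]

theorem layoutAbove_succ_self (m : ℕ) : layoutAbove (m + 1) m = {0} := by
  simp [layoutAbove, Finset.Ioo_add_one_right_eq_Ioc]

theorem cost_luredMatching (hε : ε < 1) (n : ℕ) :
    cost (luredMatching ε n) = 2 ^ n - 1 - n * ε := by
  induction n with
  | zero => simp [luredMatching, cost]
  | succ n ih =>
    have hpow : (1 : ℝ) ≤ 2 ^ n := one_le_pow₀ one_le_two
    rw [luredMatching_succ, cost_cons, ih, lure, pow_succ, abs_of_nonpos (by linarith)]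
    push_cast
    ring

theorem cost_shiftedMatching (hε : 0 ≤ ε) (m : ℕ) :
    cost (shiftedMatching ε (m + 1)) = 1 + (m + 1) * ε := by
  induction m with
  | zero => simp [shiftedMatching, cost, lure, serverPos_one, abs_of_nonneg (add_nonneg _ hε)]
  | succ m ih =>
    rw [shiftedMatching_succ, cost_cons, ih, lure, serverPos_add_two, add_sub_cancel_left,
      abs_of_nonneg hε]
    push_cast
    ring

theorem isFeasible_shiftedMatching (ε : ℝ) (k : ℕ) :
    IsFeasible (layout k) (fun _ => 1) (lures ε k) (shiftedMatching ε k) := by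
  refine ⟨by simp [shiftedMatching, lures, Function.comp_def], fun e he => ?_, fun s _ => ?_⟩
  · simp only [shiftedMatching, List.mem_reverse, List.mem_map, List.mem_range] at he
    obtain ⟨i, hi, rfl⟩ := he
    exact mem_layout.mpr ⟨i, hi, rfl⟩
  · have hnodup := (List.nodup_range (n := k)).map strictMono_serverPos_succ.injective
    simpa [load, shiftedMatching, Function.comp_def] using
      List.nodup_iff_count_le_one.mp hnodup s

theorem OnlineAlgorithm.IsGreedy.choose_lure {G : OnlineAlgorithm S c} (hG : G.IsGreedy)
    (hε : 0 < ε) (hε' : ε < 1) {i : ℕ} (hik : i + 1 < k) (hfree : free S c M = layoutAbove k i) :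
    G.choose M (lure ε i) = 2 ^ (i + 1) := by
  have hpow : (1 : ℝ) ≤ 2 ^ i := one_le_pow₀ one_le_two
  have hdist : |lure ε i - 2 ^ (i + 1)| = 2 ^ i - ε := by
    rw [lure, pow_succ, abs_of_nonpos (by linarith)]
    ring
  have hmem : (2 : ℝ) ^ (i + 1) ∈ layoutAbove k i :=
    Finset.mem_insert_of_mem (Finset.mem_image_of_mem _ (Finset.mem_Ioo.mpr ⟨i.lt_succ_self, hik⟩))
  refine hG.choose_eq (hfree ▸ hmem) fun t ht hne => ?_
  rw [hfree] at ht
  rw [hdist]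
  rcases Finset.mem_insert.mp ht with rfl | ht
  · rw [lure, sub_zero]
    linarith [le_abs_self ((2 : ℝ) ^ i + ε)]
  · obtain ⟨j, hj, rfl⟩ := Finset.mem_image.mp ht
    have hij : i + 2 ≤ j := by
      have hj₁ : j ≠ i + 1 := fun h => hne (h ▸ rfl)
      have := (Finset.mem_Ioo.mp hj).1
      omega
    have hfar : (2 : ℝ) ^ (i + 2) ≤ 2 ^ j := pow_le_pow_right₀ one_le_two hij
    rw [pow_add] at hfar
    rw [lure]
    linarith [neg_le_abs ((2 : ℝ) ^ i + ε - 2 ^ j)]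

theorem OnlineAlgorithm.IsGreedy.runFrom_lures {G : OnlineAlgorithm S c} (hG : G.IsGreedy)
    (hε : 0 < ε) (hε' : ε < 1) (hfree : free S c M = layoutAbove k 0)
    (hM : ∀ s ∈ layoutAbove k 0, c s ≤ load M s + 1) (hnk : n < k) :
    G.runFrom M (lures ε n) = luredMatching ε n ++ M ∧
      free S c (luredMatching ε n ++ M) = layoutAbove k n := by
  induction n with
  | zero => exact ⟨rfl, hfree⟩
  | succ n ih =>
    obtain ⟨hrun, hfree_n⟩ := ih (by omega)
    have hmem : (2 : ℝ) ^ (n + 1) ∈ layoutAbove k 0 := Finset.mem_insert_of_mem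
      (Finset.mem_image_of_mem _ (Finset.mem_Ioo.mpr ⟨n.succ_pos, hnk⟩))
    have hfull : c (2 ^ (n + 1)) ≤ load (luredMatching ε n ++ M) (2 ^ (n + 1)) + 1 := by
      have := hM _ hmem
      rw [load_append]
      omega
    constructor
    · rw [lures_succ, runFrom_append, hrun, OnlineAlgorithm.runFrom,
        hG.choose_lure hε hε' hnk hfree_n, luredMatching_succ]
      rfl
    · rw [luredMatching_succ, List.cons_append, free_cons_of_le_load_add_one hfull, hfree_n,
        layoutAbove_erase]

/-- When all other servers are full, the last lure has to return to the server `0`. -/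
theorem OnlineAlgorithm.IsGreedy.cost_runFrom_lures {G : OnlineAlgorithm S c} (hG : G.IsGreedy)
    (hε : 0 < ε) (hε' : ε < 1) (hfree : free S c M = layoutAbove (m + 1) 0)
    (hM : ∀ s ∈ layoutAbove (m + 1) 0, c s ≤ load M s + 1) :
    cost (G.runFrom M (lures ε (m + 1))) = 2 ^ (m + 1) - 1 - (m - 1) * ε + cost M := by
  obtain ⟨hrun, hfree_m⟩ := hG.runFrom_lures hε hε' hfree hM m.lt_succ_self
  rw [layoutAbove_succ_self] at hfree_m
  have hchoose : G.choose (luredMatching ε m ++ M) (lure ε m) = 0 := by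
    have := G.choose_mem _ (lure ε m) (hfree_m ▸ Finset.singleton_nonempty 0)
    rwa [hfree_m, Finset.mem_singleton] at this
  have hpow : (0 : ℝ) < 2 ^ m := by positivity
  rw [lures_succ, runFrom_append, hrun, OnlineAlgorithm.runFrom, OnlineAlgorithm.runFrom, hchoose,
    cost_cons, cost_append, cost_luredMatching hε', lure, sub_zero, abs_of_pos (by linarith)]
  ring

theorem OnlineAlgorithm.IsGreedy.le_mul_of_isCompetitive {G : OnlineAlgorithm (layout (m + 1)) c}
    (hG : G.IsGreedy) (hc : ∀ s ∈ layout (m + 1), 1 ≤ c s) {ρ : ℝ} (hρ : 0 ≤ ρ)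
    (hcomp : G.IsCompetitive ρ) (hε : 0 < ε) (hε' : ε < 1) :
    2 ^ (m + 1) - 1 - (m - 1) * ε ≤ ρ * (1 + (m + 1) * ε) := by
  obtain ⟨τ, hτS, hτ⟩ := exists_list_count (layout (m + 1)) fun s => c s - 1
  have hload s (hs : s ∈ layout (m + 1)) : load (diagonal τ) s + 1 = c s := by
    simp only [load_diagonal, hτ s hs, Nat.sub_add_cancel (hc s hs)]
  have hfeas : IsFeasible (layout (m + 1)) c (τ ++ lures ε (m + 1))
      (shiftedMatching ε (m + 1) ++ diagonal τ) :=
    ((isFeasible_diagonal hτS).append (isFeasible_shiftedMatching ε (m + 1))).mono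
      fun s hs => (hτ s hs ▸ Nat.sub_add_cancel (hc s hs)).le
  have hrun : G.runFrom [] τ = diagonal τ := by
    simpa using hG.runFrom_eq_diagonal_append (M := []) hτS fun s hs => by
      simp [load, hτ s hs]
  have hfree : free (layout (m + 1)) c (diagonal τ) = layoutAbove (m + 1) 0 := by
    rw [← layout_succ_eq_layoutAbove]
    exact Finset.filter_true_of_mem fun s hs => hload s hs ▸ Nat.lt_succ_self _
  calc (2 : ℝ) ^ (m + 1) - 1 - (m - 1) * ε = G.totalCost (τ ++ lures ε (m + 1)) := by
        rw [OnlineAlgorithm.totalCost, runFrom_append, hrun,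
          hG.cost_runFrom_lures hε hε' hfree, cost_diagonal, add_zero]
        exact layout_succ_eq_layoutAbove m ▸ fun s hs => (hload s hs).ge
    _ ≤ ρ * opt (layout (m + 1)) c (τ ++ lures ε (m + 1)) := hcomp _ hfeas.length_le
    _ ≤ ρ * cost (shiftedMatching ε (m + 1) ++ diagonal τ) :=
        mul_le_mul_of_nonneg_left (opt_le_cost hfeas) hρ
    _ = ρ * (1 + (m + 1) * ε) := by
        rw [cost_append, cost_diagonal, add_zero, cost_shiftedMatching hε.le]

theorem OnlineAlgorithm.IsGreedy.le_competitiveRatio (hk : 1 ≤ k) (hc : ∀ s ∈ layout k, 1 ≤ c s)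
    {G : OnlineAlgorithm (layout k) c} (hG : G.IsGreedy) :
    (((2 : ℝ) ^ k - 1 : ℝ) : EReal) ≤ G.competitiveRatio := by
  obtain ⟨m, rfl⟩ := Nat.exists_eq_add_of_le' hk
  refine le_sInf ?_
  rintro _ ⟨ρ, ⟨hρ, hcomp⟩, rfl⟩
  refine EReal.coe_le_coe_iff.mpr ?_
  have hcost : Tendsto (fun ε : ℝ => (2 : ℝ) ^ (m + 1) - 1 - (m - 1) * ε) (𝓝[>] 0)
      (𝓝 (2 ^ (m + 1) - 1)) :=
    (Continuous.tendsto' (by fun_prop) 0 _ (by simp)).mono_left nhdsWithin_le_nhds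
  have hopt : Tendsto (fun ε : ℝ => ρ * (1 + (m + 1) * ε)) (𝓝[>] 0) (𝓝 ρ) :=
    (Continuous.tendsto' (by fun_prop) 0 _ (by simp)).mono_left nhdsWithin_le_nhds
  refine le_of_tendsto_of_tendsto hcost hopt ?_
  filter_upwards [Ioo_mem_nhdsGT one_pos] with ε hε
  exact hG.le_mul_of_isCompetitive hc (zero_le_one.trans hρ) hcomp hε.1 hε.2

end Greedy

end OFAL

theorem mainTheorem3 (k : ℕ) (hk : 1 ≤ k) :
    OFAL.alpha (OFAL.layout k) ≤ 2 ∧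
    (3 ≤ k → OFAL.alpha (OFAL.layout k) = 2) ∧
    ∀ c : ℝ → ℕ, (∀ s ∈ OFAL.layout k, 1 ≤ c s) →
      (∀ g : OFAL.SplitRule, (OFAL.ptcp g (OFAL.layout k) c).IsCompetitive 5) ∧
      ∀ G : OFAL.OnlineAlgorithm (OFAL.layout k) c, G.IsGreedy →
        (((2 : ℝ) ^ k - 1 : ℝ) : EReal) ≤ G.competitiveRatio :=
  ⟨OFAL.alpha_layout_le k, OFAL.alpha_layout_eq, fun c hc =>
    ⟨fun g => OFAL.isCompetitive_ptcp_layout g k c, fun _ hG => hG.le_competitiveRatio hk hc⟩⟩
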